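/- Let $d\in\mathbb N$ and $p\in[1,\infty)$. For finite Borel measures $\alpha,\beta$ on $\mathbb R^d$ of equal total mass let $$W_p(\alpha,\beta)=\Big(\inf_{\pi\in\Pi(\alpha,\beta)}\int_{\mathbb R^d\times\mathbb R^d}|u-v|^p\,\pi(du\,dv)\Big)^{1/p}\in[0,\infty],$$ where $\Pi(\alpha,\beta)$ is the set of Borel measures on $\mathbb R^d\times\mathbb R^d$ with first marginal $\alpha$ and second marginal $\beta$. For a Borel probability measure $\mu$ on $\mathbb R^d$ and $x,y\in\mathbb R^d$ define the conditional Wasserstein distance $$W_p(x,y\|\mu)=\lim_{\varepsilon\to0^+}\varepsilon^{-1}\,W_p(\mu+\varepsilon\delta_x,\ \mu+\varepsilon\delta_y).$$ Lemma. For every Borel probability measure $\mu$ on $\mathbb R^d$ and all $x,y\in\mathbb R^d$ this limit exists in $[0,\infty]$, and: 1. For all $x,y\in\mathbb R^d$, the map $\mu\mapsto W_p^p(x,y\|\mu)=\big(W_p(x,y\|\mu)\big)^p\in[0,\infty]$ is convex on the set of Borel probability measures on $\mathbb R^d$. 2. For every Borel probability measure $\mu$ on $\mathbb R^d$, $W_p(\cdot,\cdot\|\mu)$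 is an extended metric on $\mathbb R^d$: it takes values in $[0,\infty]$, $W_p(x,y\|\mu)=0$ if and only if $x=y$, $W_p(x,y\|\mu)=W_p(y,x\|\mu)$, and $W_p(x,z\|\mu)\le W_p(x,y\|\mu)+W_p(y,z\|\mu)$ for all $x,y,z\in\mathbb R^d$. -/

import Mathlib

open MeasureTheory Filter Topology
open scoped ENNReal NNReal

noncomputable section

namespace CondWasserstein

variable {X : Type*} [MeasurableSpace X]

/-- The set `Π(α, β)` of transport plans: measures on the product with marginals `α` and `β`. -/
def plans (α β : Measure X) : Set (Measure (X × X)) :=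
  {π | π.map Prod.fst = α ∧ π.map Prod.snd = β}

/-- The Wasserstein distance `W_p(α, β) = (inf over plans of ∫∫ |x - y|^p dπ)^(1/p)`, with values in
`[0, ∞]`, for two measures of the same total mass (not necessarily of mass one). -/
def wasserstein [EDist X] (p : ℝ) (α β : Measure X) : ℝ≥0∞ :=
  (⨅ π ∈ plans α β, ∫⁻ z, edist z.1 z.2 ^ p ∂π) ^ (1 / p)

/-- The difference quotient `ε⁻¹ W_p(μ + ε ν₊, μ + ε ν₋)`. -/
def quotient [EDist X] (p : ℝ) (ν₁ ν₂ μ : Measure X) (ε : ℝ≥0) : ℝ≥0∞ :=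
  (ε : ℝ≥0∞)⁻¹ * wasserstein p (μ + ε • ν₁) (μ + ε • ν₂)

/-- The conditional Wasserstein metric
`W_p(ν₊, ν₋ ‖ μ) = lim_{ε → 0, ε > 0} ε⁻¹ W_p(μ + ε ν₊, μ + ε ν₋)`. -/
def condWasserstein [EDist X] (p : ℝ) (ν₁ ν₂ μ : Measure X) : ℝ≥0∞ :=
  limUnder (𝓝[>] (0 : ℝ≥0)) (quotient p ν₁ ν₂ μ)

/-- `W_p(x, y ‖ μ) = W_p(δ_x, δ_y ‖ μ)`. -/
def condDist [EDist X] (p : ℝ) (μ : Measure X) (x y : X) : ℝ≥0∞ :=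
  condWasserstein p (Measure.dirac x) (Measure.dirac y) μ

end CondWasserstein

end

open MeasureTheory Filter Topology ProbabilityTheory
open scoped ENNReal NNReal

/-! Put f(ε) = W_p(μ + εδ_x, μ + εδ_y). Moving the extra mass in two portions, with shared mass left
in place, makes f subadditive (`wasserstein_triangle`, `wasserstein_add_right_le`), and f(ε) → 0 at
0. By a Fekete-type argument the slopes f(ε)/ε converge to their supremum
(`tendsto_slope_of_subadditive`).

With a supremum in place of the limit, the triangle inequality and convexity pass from each fixed ε.
Convexity holds there because optimal cost is subadditive and homogeneous. Separation needs only ε =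
1: a Lipschitz test function and Hölder bound f(1) below. -/

namespace CondWasserstein

/-! ### Algebra of the transport cost -/

section Cost

variable {X : Type*} [MeasurableSpace X]

/-- The optimal transport cost, i.e. the `p`-th power of the Wasserstein distance. -/
noncomputable def transportCost [EDist X] (p : ℝ) (α β : Measure X) : ℝ≥0∞ :=
  ⨅ π ∈ plans α β, ∫⁻ z, edist z.1 z.2 ^ p ∂π

theorem wasserstein_eq [EDist X] (p : ℝ) (α β : Measure X) :
    wasserstein p α β = transportCost p α β ^ (1 / p) := rfl

theorem wasserstein_rpow [EDist X] {p : ℝ} (hp : 0 < p) (α β : Measure X) :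
    wasserstein p α β ^ p = transportCost p α β := by
  rw [wasserstein_eq, ← ENNReal.rpow_mul, one_div_mul_cancel hp.ne', ENNReal.rpow_one]

theorem wasserstein_eq_iInf [EDist X] {p : ℝ} (hp : 0 < p) (α β : Measure X) :
    wasserstein p α β = ⨅ π ∈ plans α β, (∫⁻ z, edist z.1 z.2 ^ p ∂π) ^ (1 / p) :=
  (ENNReal.orderIsoRpow (1 / p) (by positivity)).map_iInf₂ _

theorem transportCost_le [EDist X] (p : ℝ) {α β : Measure X} {π : Measure (X × X)}
    (h : π ∈ plans α β) : transportCost p α β ≤ ∫⁻ z, edist z.1 z.2 ^ p ∂π :=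
  iInf₂_le π h

theorem add_mem_plans {α β α' β' : Measure X} {π π' : Measure (X × X)}
    (h : π ∈ plans α β) (h' : π' ∈ plans α' β') : π + π' ∈ plans (α + α') (β + β') := by
  refine ⟨?_, ?_⟩
  · rw [Measure.map_add _ _ measurable_fst, h.1, h'.1]
  · rw [Measure.map_add _ _ measurable_snd, h.2, h'.2]

theorem smul_mem_plans {α β : Measure X} {π : Measure (X × X)} (c : ℝ≥0)
    (h : π ∈ plans α β) : c • π ∈ plans (c • α) (c • β) := by
  refine ⟨?_, ?_⟩
  · rw [Measure.map_smul, h.1]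
  · rw [Measure.map_smul, h.2]

theorem swap_mem_plans {α β : Measure X} {π : Measure (X × X)}
    (h : π ∈ plans α β) : π.map Prod.swap ∈ plans β α := by
  refine ⟨?_, ?_⟩
  · rw [Measure.map_map measurable_fst measurable_swap]; exact h.2
  · rw [Measure.map_map measurable_snd measurable_swap]; exact h.1

theorem transportCost_add_le [EDist X] (p : ℝ) (α β α' β' : Measure X) :
    transportCost p (α + α') (β + β') ≤ transportCost p α β + transportCost p α' β' := by
  simp_rw [transportCost, ENNReal.iInf_add, ENNReal.add_iInf]
  refine le_iInf₂ fun π h => le_iInf₂ fun π' h' => ?_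
  exact (transportCost_le p (add_mem_plans h h')).trans_eq (lintegral_add_measure _ _ _)

theorem transportCost_smul_le [EDist X] (p : ℝ) (c : ℝ≥0) (α β : Measure X) :
    transportCost p (c • α) (c • β) ≤ c * transportCost p α β := by
  rcases eq_or_ne c 0 with rfl | hc
  · have h : (0 : Measure (X × X)) ∈ plans ((0 : ℝ≥0) • α) ((0 : ℝ≥0) • β) := by
      simp [plans]
    exact (transportCost_le p h).trans (by simp)
  · have hc' : (c : ℝ≥0∞) ≠ 0 := by simpa using hc
    rw [transportCost, transportCost, ENNReal.mul_iInf_of_ne hc' ENNReal.coe_ne_top]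
    refine le_iInf fun π => ?_
    rw [ENNReal.mul_iInf_of_ne hc' ENNReal.coe_ne_top]
    refine le_iInf fun h => ?_
    refine (transportCost_le p (smul_mem_plans c h)).trans_eq ?_
    rw [lintegral_smul_measure]; rfl

end Cost

/-! ### Wasserstein distance: symmetry, gluing, triangle inequality -/

section Metric

variable {X : Type*} [MetricSpace X] [MeasurableSpace X] [BorelSpace X]
  [SecondCountableTopology X]

theorem measurable_edist_rpow (p : ℝ) :
    Measurable fun z : X × X => edist z.1 z.2 ^ p :=
  (measurable_fst.edist measurable_snd).pow_const p

theorem transportCost_swap_le (p : ℝ) (α β : Measure X) :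
    transportCost p β α ≤ transportCost p α β := by
  refine le_iInf₂ fun π h => (transportCost_le p (swap_mem_plans h)).trans_eq ?_
  rw [lintegral_map (measurable_edist_rpow p) measurable_swap]
  simp [edist_comm]

theorem wasserstein_comm (p : ℝ) (α β : Measure X) :
    wasserstein p α β = wasserstein p β α := by
  rw [wasserstein_eq, wasserstein_eq,
    (transportCost_swap_le p α β).antisymm (transportCost_swap_le p β α)]

theorem transportCost_self {p : ℝ} (hp : 0 < p) (α : Measure X) :
    transportCost p α α = 0 := by
  have hm : Measurable fun u : X => (u, u) := measurable_id.prodMk measurable_id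
  have h : α.map (fun u => (u, u)) ∈ plans α α := by
    refine ⟨?_, ?_⟩
    · rw [Measure.map_map measurable_fst hm]; exact Measure.map_id
    · rw [Measure.map_map measurable_snd hm]; exact Measure.map_id
  refine le_antisymm ((transportCost_le p h).trans_eq ?_) bot_le
  rw [lintegral_map (measurable_edist_rpow p) hm]
  simp [hp]

/-- The shared mass `ρ` can stay put on the diagonal at zero cost. -/
theorem wasserstein_add_right_le {p : ℝ} (hp : 0 < p) (α β ρ : Measure X) :
    wasserstein p (α + ρ) (β + ρ) ≤ wasserstein p α β := by
  rw [wasserstein_eq, wasserstein_eq]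
  refine ENNReal.rpow_le_rpow ?_ (by positivity)
  simpa [transportCost_self hp] using transportCost_add_le p α β ρ ρ

theorem transportCost_dirac_le (p : ℝ) (x y : X) :
    transportCost p (Measure.dirac x) (Measure.dirac y) ≤ edist x y ^ p := by
  have h : Measure.dirac (x, y) ∈ plans (Measure.dirac x) (Measure.dirac y) :=
    ⟨Measure.map_dirac' measurable_fst _, Measure.map_dirac' measurable_snd _⟩
  refine (transportCost_le p h).trans_eq ?_
  rw [lintegral_dirac' _ (measurable_edist_rpow p)]

theorem wasserstein_smul_dirac_le {p : ℝ} (hp : 0 < p) (μ : Measure X) (x y : X) (r : ℝ≥0) :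
    wasserstein p (μ + r • Measure.dirac x) (μ + r • Measure.dirac y)
      ≤ ((r : ℝ≥0∞) * edist x y ^ p) ^ (1 / p) := by
  rw [add_comm μ, add_comm μ]
  refine (wasserstein_add_right_le hp _ _ μ).trans ?_
  rw [wasserstein_eq]
  refine ENNReal.rpow_le_rpow ?_ (by positivity)
  exact (transportCost_smul_le p r _ _).trans (by gcongr; exact transportCost_dirac_le p x y)

theorem condDist_comm (p : ℝ) (μ : Measure X) (x y : X) :
    condDist p μ x y = condDist p μ y x := by
  unfold condDist condWasserstein
  congr 1
  funext ε
  rw [quotient, quotient, wasserstein_comm]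

/-- Gluing of two transport plans along their common marginal. -/
theorem exists_glue [CompleteSpace X] {α β γ : Measure X} [IsFiniteMeasure β]
    {π₁ π₂ : Measure (X × X)} (h₁ : π₁ ∈ plans α β) (h₂ : π₂ ∈ plans β γ) :
    ∃ ρ : Measure (X × X × X), ρ.map (fun w => (w.2.1, w.1)) = π₁ ∧
      ρ.map (fun w => (w.1, w.2.2)) = π₂ := by
  rcases isEmpty_or_nonempty X with hX | hX
  · exact ⟨0, Subsingleton.elim _ _, Subsingleton.elim _ _⟩
  have hfin : ∀ {π : Measure (X × X)}, π.map Prod.fst = β → IsFiniteMeasure π := by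
    intro π h
    refine ⟨?_⟩
    have := congrArg (fun m : Measure X => m Set.univ) h
    simp only [Measure.map_apply measurable_fst MeasurableSet.univ, Set.preimage_univ] at this
    rw [this]; exact measure_lt_top _ _
  have hs := swap_mem_plans h₁
  have i₁ := hfin hs.1
  have i₂ := hfin h₂.1
  set σ := π₁.map Prod.swap with hσ
  -- Disintegrate both plans over `β` and make the outer points conditionally independent given the
  -- middle one, which is the first coordinate.
  refine ⟨β ⊗ₘ (σ.condKernel ×ₖ π₂.condKernel), ?_, ?_⟩
  · have e : (β ⊗ₘ (σ.condKernel ×ₖ π₂.condKernel)).map (Prod.map id Prod.fst) = σ := by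
      rw [← Measure.compProd_map measurable_fst, ← Kernel.fst_eq, Kernel.fst_prod]
      conv_rhs => rw [← σ.disintegrate σ.condKernel]
      rw [Measure.fst, hs.1]
    have : (fun w : X × X × X => (w.2.1, w.1)) = Prod.swap ∘ Prod.map id Prod.fst := rfl
    rw [this, ← Measure.map_map measurable_swap (by fun_prop), e, hσ,
      Measure.map_map measurable_swap measurable_swap, Prod.swap_swap_eq, Measure.map_id]
  · change (β ⊗ₘ (σ.condKernel ×ₖ π₂.condKernel)).map (Prod.map id Prod.snd) = π₂
    rw [← Measure.compProd_map measurable_snd, ← Kernel.snd_eq, Kernel.snd_prod]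
    conv_rhs => rw [← π₂.disintegrate π₂.condKernel]
    rw [Measure.fst, h₂.1]

theorem wasserstein_triangle [CompleteSpace X] {p : ℝ} (hp : 1 ≤ p) (α β γ : Measure X)
    [IsFiniteMeasure β] :
    wasserstein p α γ ≤ wasserstein p α β + wasserstein p β γ := by
  have hp0 : 0 < p := by linarith
  rw [wasserstein_eq_iInf hp0 α β, wasserstein_eq_iInf hp0 β γ]
  simp_rw [ENNReal.iInf_add, ENNReal.add_iInf]
  refine le_iInf₂ fun π₁ h₁ => le_iInf₂ fun π₂ h₂ => ?_
  obtain ⟨ρ, e₁, e₂⟩ := exists_glue h₁ h₂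
  have m₁ : Measurable fun w : X × X × X => (w.2.1, w.1) := by fun_prop
  have m₂ : Measurable fun w : X × X × X => (w.1, w.2.2) := by fun_prop
  have hρ : ρ.map Prod.snd ∈ plans α γ := by
    refine ⟨?_, ?_⟩
    · rw [Measure.map_map measurable_fst measurable_snd, ← h₁.1, ← e₁,
        Measure.map_map measurable_fst m₁]; rfl
    · rw [Measure.map_map measurable_snd measurable_snd, ← h₂.2, ← e₂,
        Measure.map_map measurable_snd m₂]; rfl
  refine (ENNReal.rpow_le_rpow (transportCost_le p hρ) (by positivity)).trans ?_
  rw [← e₁, ← e₂, lintegral_map (measurable_edist_rpow p) m₁,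
    lintegral_map (measurable_edist_rpow p) m₂,
    lintegral_map (measurable_edist_rpow p) measurable_snd]
  refine le_trans ?_ (ENNReal.lintegral_Lp_add_le (μ := ρ)
    (f := fun w => edist w.2.1 w.1) (g := fun w => edist w.1 w.2.2)
    (by fun_prop) (by fun_prop) hp)
  gcongr with w
  exact edist_triangle _ _ _

end Metric

/-- A subadditive function tending to `0` at `0` has a slope at `0`, the supremum of its slopes. -/
theorem tendsto_slope_of_subadditive {f : ℝ≥0 → ℝ≥0∞} (hadd : ∀ s t, f (s + t) ≤ f s + f t)
    (h0 : Tendsto f (𝓝 0) (𝓝 0)) :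
    Tendsto (fun ε : ℝ≥0 => (ε : ℝ≥0∞)⁻¹ * f ε) (𝓝[>] 0)
      (𝓝 (⨆ ε : ℝ≥0, ⨆ _ : 0 < ε, (ε : ℝ≥0∞)⁻¹ * f ε)) := by
  refine tendsto_order.2 ⟨fun a ha => ?_, fun a ha => ?_⟩
  · simp only [lt_iSup_iff] at ha
    obtain ⟨t, ht, hat⟩ := ha
    have ht' : (t : ℝ≥0∞) ≠ 0 := by simpa using ht.ne'
    have hat' : t * a < f t := by
      rw [← ENNReal.div_eq_inv_mul] at hat
      rw [mul_comm]
      exact (ENNReal.lt_div_iff_mul_lt (.inl ht') (.inl ENNReal.coe_ne_top)).1 hat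
    -- The strict gap between `t * a` and `f t` absorbs `f r` for all small remainders `r`.
    have hlim : Tendsto (fun r => t * a + f r) (𝓝 0) (𝓝 (t * a)) := by
      simpa using tendsto_const_nhds.add h0
    have hev := (hlim.eventually (gt_mem_nhds hat'))
    obtain ⟨δ, hδ, hsub⟩ := (nhds_bot_basis (α := ℝ≥0)).mem_iff.1 hev
    have hIoo : Set.Ioo 0 δ ∈ 𝓝[>] (0 : ℝ≥0) := Ioo_mem_nhdsGT hδ
    filter_upwards [hIoo] with ε hε
    have hn : ∀ (n : ℕ) (r : ℝ≥0), f (n * ε + r) ≤ n * f ε + f r := by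
      intro n r
      induction n with
      | zero => simp
      | succ n ih =>
        calc f ((n + 1 : ℕ) * ε + r) = f (ε + (n * ε + r)) := by congr 1; push_cast; ring
          _ ≤ f ε + (n * f ε + f r) := (hadd _ _).trans (by gcongr)
          _ = _ := by push_cast; ring
    have hε0 : (ε : ℝ≥0∞) ≠ 0 := by simpa using hε.1.ne'
    -- Division with remainder: `t = n * ε + r` with `r < ε < δ`.
    set n := ⌊t / ε⌋₊
    have hnt : n * ε ≤ t := by
      rw [← le_div_iff₀ hε.1]; exact Nat.floor_le (by positivity)
    have hr : t - n * ε < ε := by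
      have := Nat.lt_floor_add_one (t / ε)
      rw [div_lt_iff₀ hε.1] at this
      rw [tsub_lt_iff_left hnt]
      calc t < _ := this
        _ = n * ε + ε := by ring
    have hr' : t * a + f (t - n * ε) < f t := hsub (hr.trans hε.2)
    have h1 : f t ≤ n * f ε + f (t - n * ε) := by
      simpa [add_tsub_cancel_of_le hnt] using hn n (t - n * ε)
    have h2 : (n : ℝ≥0∞) * f ε ≤ t * ((ε : ℝ≥0∞)⁻¹ * f ε) := by
      rw [← mul_assoc]
      gcongr
      rw [← ENNReal.div_eq_inv_mul.trans (mul_comm _ _),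
        ENNReal.le_div_iff_mul_le (.inl hε0) (.inl ENNReal.coe_ne_top)]
      exact_mod_cast hnt
    have h3 := (hr'.trans_le (h1.trans (by gcongr)) : _ < t * ((ε : ℝ≥0∞)⁻¹ * f ε) + f (t - n * ε))
    exact lt_of_mul_lt_mul_left' (lt_of_add_lt_add_right h3)
  · filter_upwards [self_mem_nhdsWithin] with ε hε
    exact (le_iSup₂ (f := fun (ε : ℝ≥0) (_ : 0 < ε) => (ε : ℝ≥0∞)⁻¹ * f ε) ε hε).trans_lt ha

/-! ### Lower bound by duality -/

section TestFunction

variable {X : Type*} [MetricSpace X] [MeasurableSpace X] [BorelSpace X]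

/-- Any plan moving `r` units of extra mass from `x` to `y` pays at least `r * edist x y`: test
against the `1`-Lipschitz function `u ↦ (edist x y - edist u x)⁺`. -/
theorem smul_edist_le_lintegral {μ : Measure X} [IsFiniteMeasure μ] {x y : X} {r : ℝ≥0}
    {π : Measure (X × X)}
    (h : π ∈ plans (μ + r • Measure.dirac x) (μ + r • Measure.dirac y)) :
    r * edist x y ≤ ∫⁻ z, edist z.1 z.2 ∂π := by
  set g : X → ℝ≥0∞ := fun u => edist x y - edist u x with hg
  have hgm : Measurable g := by fun_prop
  have hgl : ∀ z : X × X, g z.1 ≤ g z.2 + edist z.1 z.2 := by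
    intro z
    simp only [hg]
    rw [tsub_le_iff_right, add_assoc]
    refine tsub_le_iff_right.1 (tsub_le_tsub_left ?_ _)
    rw [edist_comm z.1 z.2, add_comm]
    exact (edist_triangle z.2 z.1 x).trans_eq (add_comm _ _)
  -- Finiteness allows the common `μ`-integral to be cancelled at the end.
  have hfin : ∫⁻ u, g u ∂μ ≠ ∞ := by
    refine ((lintegral_mono (g := fun _ => edist x y) fun u => tsub_le_self).trans_lt ?_).ne
    rw [lintegral_const]
    exact ENNReal.mul_lt_top (edist_lt_top x y) (measure_lt_top _ _)
  have key : ∫⁻ u, g u ∂(μ + r • Measure.dirac x)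
      ≤ ∫⁻ u, g u ∂(μ + r • Measure.dirac y) + ∫⁻ z, edist z.1 z.2 ∂π := by
    rw [← h.1, ← h.2, lintegral_map hgm measurable_fst, lintegral_map hgm measurable_snd,
      ← lintegral_add_left (by fun_prop)]
    exact lintegral_mono hgl
  rw [lintegral_add_measure, lintegral_add_measure, lintegral_smul_measure,
    lintegral_smul_measure, lintegral_dirac' _ hgm, lintegral_dirac' _ hgm] at key
  have gx : g x = edist x y := by simp [hg]
  have gy : g y = 0 := by simp [hg, edist_comm]
  rw [gx, gy, smul_zero, add_zero] at key
  exact (ENNReal.add_le_add_iff_left hfin).1 key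

/-- Hölder on each plan, whose total mass is that of its marginal, turns the bound for exponent 1
into one for `p`. -/
theorem smul_edist_le_wasserstein_mul [SecondCountableTopology X] {p : ℝ} (hp : 1 ≤ p)
    (μ : Measure X) [IsFiniteMeasure μ] (x y : X) {r : ℝ≥0} (hr : 0 < r) :
    r * edist x y ≤ wasserstein p (μ + r • Measure.dirac x) (μ + r • Measure.dirac y)
      * (μ + r • Measure.dirac x) Set.univ ^ (1 - 1 / p) := by
  have hp0 : 0 < p := by linarith
  have hle : 0 ≤ 1 - 1 / p := by
    rw [sub_nonneg, div_le_one hp0]; exact hp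
  have hM0 : (μ + r • Measure.dirac x) Set.univ ≠ 0 := by
    simp [hr.ne']
  have hM : (μ + r • Measure.dirac x) Set.univ ≠ ∞ := measure_ne_top _ _
  have hc0 : (μ + r • Measure.dirac x) Set.univ ^ (1 - 1 / p) ≠ 0 := by
    rw [Ne, ENNReal.rpow_eq_zero_iff]
    exact fun h => h.elim (fun h => hM0 h.1) (fun h => hM h.1)
  have hc : (μ + r • Measure.dirac x) Set.univ ^ (1 - 1 / p) ≠ ∞ :=
    ENNReal.rpow_ne_top_of_nonneg hle hM
  rw [wasserstein_eq_iInf hp0, ENNReal.iInf_mul_of_ne hc0 hc]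
  refine le_iInf fun π => ?_
  rw [ENNReal.iInf_mul_of_ne hc0 hc]
  refine le_iInf fun h => (smul_edist_le_lintegral h).trans ?_
  have hu : π Set.univ = (μ + r • Measure.dirac x) Set.univ := by
    rw [← h.1, Measure.map_apply measurable_fst MeasurableSet.univ, Set.preimage_univ]
  have := eLpNorm'_le_eLpNorm'_mul_rpow_measure_univ (μ := π) one_pos hp
    (f := fun z : X × X => edist z.1 z.2)
    (measurable_fst.edist measurable_snd).aestronglyMeasurable
  simpa [eLpNorm', hu] using this

end TestFunction

/-! ### The limit as a supremum, and its consequences -/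

section Slope

variable {X : Type*} [MetricSpace X] [MeasurableSpace X] [BorelSpace X]
  [SecondCountableTopology X] [CompleteSpace X]

theorem tendsto_quotient_iSup {p : ℝ} (hp : 1 ≤ p) (μ : Measure X) [IsFiniteMeasure μ] (x y : X) :
    Tendsto (quotient p (Measure.dirac x) (Measure.dirac y) μ) (𝓝[>] 0)
      (𝓝 (⨆ ε : ℝ≥0, ⨆ _ : 0 < ε, quotient p (Measure.dirac x) (Measure.dirac y) μ ε)) := by
  have hp0 : 0 < p := by linarith
  refine tendsto_slope_of_subadditive
    (f := fun ε => wasserstein p (μ + ε • Measure.dirac x) (μ + ε • Measure.dirac y)) ?_ ?_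
  · intro s t
    -- The midpoint has `s` units already moved to `y` and `t` still at `x`; each leg then has a
    -- common summand to drop.
    refine (wasserstein_triangle hp _ ((μ + s • Measure.dirac y) + t • Measure.dirac x) _).trans ?_
    refine add_le_add ?_ ?_
    · rw [add_smul, ← add_assoc]
      exact wasserstein_add_right_le hp0 _ _ _
    · rw [add_right_comm μ, add_comm s t, add_smul, ← add_assoc]
      exact wasserstein_add_right_le hp0 _ _ _
  · refine tendsto_of_tendsto_of_tendsto_of_le_of_le tendsto_const_nhds ?_ (fun _ => bot_le)
      (wasserstein_smul_dirac_le hp0 μ x y)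
    have h1 : Tendsto (fun r : ℝ≥0 => (r : ℝ≥0∞) * edist x y ^ p) (𝓝 0) (𝓝 0) := by
      have : Tendsto (fun r : ℝ≥0 => (r : ℝ≥0∞) * edist x y ^ p) (𝓝 0)
          (𝓝 (((0 : ℝ≥0) : ℝ≥0∞) * edist x y ^ p)) :=
        ENNReal.Tendsto.mul_const (ENNReal.tendsto_coe.2 tendsto_id)
          (.inr (ENNReal.rpow_ne_top_of_nonneg hp0.le (edist_ne_top x y)))
      simpa using this
    have h2 := h1.ennrpow_const (1 / p)
    rwa [ENNReal.zero_rpow_of_pos (by positivity)] at h2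

theorem condDist_eq_iSup {p : ℝ} (hp : 1 ≤ p) (μ : Measure X) [IsFiniteMeasure μ] (x y : X) :
    condDist p μ x y
      = ⨆ ε : ℝ≥0, ⨆ _ : 0 < ε, quotient p (Measure.dirac x) (Measure.dirac y) μ ε :=
  (tendsto_quotient_iSup hp μ x y).limUnder_eq

theorem quotient_le_condDist {p : ℝ} (hp : 1 ≤ p) (μ : Measure X) [IsFiniteMeasure μ] (x y : X)
    {ε : ℝ≥0} (hε : 0 < ε) :
    quotient p (Measure.dirac x) (Measure.dirac y) μ ε ≤ condDist p μ x y := by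
  rw [condDist_eq_iSup hp]
  exact le_iSup₂ (f := fun (ε : ℝ≥0) (_ : 0 < ε) =>
    quotient p (Measure.dirac x) (Measure.dirac y) μ ε) ε hε

theorem condDist_triangle {p : ℝ} (hp : 1 ≤ p) (μ : Measure X) [IsFiniteMeasure μ] (x y z : X) :
    condDist p μ x z ≤ condDist p μ x y + condDist p μ y z := by
  rw [condDist_eq_iSup hp μ x z]
  refine iSup₂_le fun ε hε => ?_
  refine le_trans ?_ (add_le_add (quotient_le_condDist hp μ x y hε)
    (quotient_le_condDist hp μ y z hε))
  rw [quotient, quotient, quotient, ← mul_add]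
  gcongr
  exact wasserstein_triangle hp _ _ _

theorem condDist_self {p : ℝ} (hp : 1 ≤ p) (μ : Measure X) [IsFiniteMeasure μ] (x : X) :
    condDist p μ x x = 0 := by
  have hp0 : 0 < p := by linarith
  rw [condDist_eq_iSup hp]
  simp [quotient, wasserstein_eq, transportCost_self hp0, hp0]

theorem condDist_eq_zero_iff {p : ℝ} (hp : 1 ≤ p) (μ : Measure X) [IsFiniteMeasure μ] (x y : X) :
    condDist p μ x y = 0 ↔ x = y := by
  have hp0 : 0 < p := by linarith
  refine ⟨fun h => ?_, fun h => h ▸ condDist_self hp μ x⟩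
  have h1 := quotient_le_condDist hp μ x y one_pos
  have h2 : wasserstein p (μ + (1 : ℝ≥0) • Measure.dirac x)
      (μ + (1 : ℝ≥0) • Measure.dirac y) = 0 := by
    rw [h, nonpos_iff_eq_zero] at h1
    simpa [quotient] using h1
  have h3 := smul_edist_le_wasserstein_mul hp μ x y one_pos
  rw [h2, zero_mul] at h3
  simpa using h3

theorem convexOn_condDist_rpow {p : ℝ} (hp : 1 ≤ p) (x y : X) :
    ConvexOn ℝ≥0 {μ : Measure X | IsProbabilityMeasure μ} (fun μ => condDist p μ x y ^ p) := by
  have hp0 : 0 < p := by linarith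
  have hconv : Convex ℝ≥0 {μ : Measure X | IsProbabilityMeasure μ} := by
    intro μ hμ ν hν a b _ _ hab
    simp only [Set.mem_ofPred_eq] at hμ hν ⊢
    refine ⟨?_⟩
    simp only [Measure.add_apply, Measure.smul_apply, measure_univ, ENNReal.smul_def, smul_eq_mul,
      mul_one]
    exact_mod_cast hab
  refine ⟨hconv, fun μ hμ ν hν a b ha hb hab => ?_⟩
  have hm := hconv hμ hν ha hb hab
  simp only [Set.mem_ofPred_eq] at hμ hν hm
  change condDist p (a • μ + b • ν) x y ^ p ≤ a * condDist p μ x y ^ p + b * condDist p ν x y ^ p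
  rw [condDist_eq_iSup hp (a • μ + b • ν), ← ENNReal.le_rpow_inv_iff hp0]
  refine iSup₂_le fun ε hε => ?_
  rw [ENNReal.le_rpow_inv_iff hp0]
  have hq : ∀ ν : Measure X, quotient p (Measure.dirac x) (Measure.dirac y) ν ε ^ p
      = (ε : ℝ≥0∞)⁻¹ ^ p
        * transportCost p (ν + ε • Measure.dirac x) (ν + ε • Measure.dirac y) := by
    intro ν
    rw [quotient, ENNReal.mul_rpow_of_nonneg _ _ hp0.le, wasserstein_rpow hp0]
  -- Since `a + b = 1`, the perturbation `ε • δ_u` splits in the same proportions as the measures.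
  have hs : ∀ u : X, a • μ + b • ν + ε • Measure.dirac u
      = a • (μ + ε • Measure.dirac u) + b • (ν + ε • Measure.dirac u) := by
    intro u
    rw [smul_add, smul_add, add_add_add_comm, smul_smul, smul_smul, ← add_smul, ← add_mul, hab,
      one_mul]
  calc quotient p (Measure.dirac x) (Measure.dirac y) (a • μ + b • ν) ε ^ p
      ≤ (ε : ℝ≥0∞)⁻¹ ^ p
        * (a * transportCost p (μ + ε • Measure.dirac x) (μ + ε • Measure.dirac y)
          + b * transportCost p (ν + ε • Measure.dirac x) (ν + ε • Measure.dirac y)) := by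
        rw [hq, hs, hs]
        gcongr
        exact (transportCost_add_le p _ _ _ _).trans
          (add_le_add (transportCost_smul_le p a _ _) (transportCost_smul_le p b _ _))
    _ = a * quotient p (Measure.dirac x) (Measure.dirac y) μ ε ^ p
        + b * quotient p (Measure.dirac x) (Measure.dirac y) ν ε ^ p := by
        rw [hq, hq]; ring
    _ ≤ a * condDist p μ x y ^ p + b * condDist p ν x y ^ p := by
        gcongr
        · exact quotient_le_condDist hp μ x y hε
        · exact quotient_le_condDist hp ν x y hε

end Slope

end CondWasserstein

theorem mainTheorem3 (d : ℕ) (p : ℝ) (hp : 1 ≤ p) :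
    -- the limit defining `W_p(x, y ‖ μ)` exists in `[0, ∞]`
    (∀ (μ : Measure (EuclideanSpace ℝ (Fin d))) [IsProbabilityMeasure μ]
        (x y : EuclideanSpace ℝ (Fin d)),
      Tendsto (CondWasserstein.quotient p (Measure.dirac x) (Measure.dirac y) μ)
        (𝓝[>] (0 : ℝ≥0)) (𝓝 (CondWasserstein.condDist p μ x y))) ∧
    -- convexity in `μ`
    (∀ x y : EuclideanSpace ℝ (Fin d),
      ConvexOn ℝ≥0 {μ : Measure (EuclideanSpace ℝ (Fin d)) | IsProbabilityMeasure μ}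
        (fun μ => CondWasserstein.condDist p μ x y ^ p)) ∧
    -- extended metric in `(x, y)`
    (∀ (μ : Measure (EuclideanSpace ℝ (Fin d))) [IsProbabilityMeasure μ],
      (∀ x y, CondWasserstein.condDist p μ x y = 0 ↔ x = y) ∧
      (∀ x y, CondWasserstein.condDist p μ x y = CondWasserstein.condDist p μ y x) ∧
      (∀ x y z, CondWasserstein.condDist p μ x z ≤
        CondWasserstein.condDist p μ x y + CondWasserstein.condDist p μ y z)) := by
  refine ⟨fun μ _ x y => ?_, CondWasserstein.convexOn_condDist_rpow hp, fun μ _ =>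
    ⟨CondWasserstein.condDist_eq_zero_iff hp μ, CondWasserstein.condDist_comm p μ,
      CondWasserstein.condDist_triangle hp μ⟩⟩
  rw [CondWasserstein.condDist_eq_iSup hp]
  exact CondWasserstein.tendsto_quotient_iSup hp μ x y
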